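/- Let $\ell^2$ be the Hilbert space of square summable (real or complex) sequences $x=(x_0,x_1,\dots)$, and let $P_k x=(x_0,\dots,x_k,0,0,\dots)$, $\widetilde Q_k=I-P_k$ for $k\ge 0$. Let $B_c$ be the algebra of causal operators, i.e. the bounded operators $A$ on $\ell^2$ with $P_kAP_k=P_kA$ for all $k\ge 0$, and let $\mathcal K$ be the space of compact operators on $\ell^2$. (a) For every $b\in\mathcal K$, $$\inf_{Q\in B_c}\|b-Q\|=\inf_{Q\in B_c\cap\mathcal K}\|b-Q\|,$$ and there is $Q_o\in B_c\cap\mathcal K$ with $\|b-Q_o\|=\inf_{Q\in B_c}\|b-Q\|$. (b) Let $T_1,T_2,T_3\in B_c$, with an inner-outer factorization $T_2=T_{2i}T_{2o}$ and a (co-)outer-inner factorization $T_3=T_{3o}T_{3i}$ in $B_c$. Here $T_{2i}\in B_c$ is inner: a partial isometry such that $T_{2i}^\star T_{2i}$ commutes with every $\widetilde Q_n$. The operator $T_{2o}\in B_c$ is outer: the orthogonal projection onto the closure of its range commutes with every $\widetilde Q_n$, and $T_{2o}\widetilde Q_n\ell^2$ is dense in $\widetilde Q_n\ell^2\cap T_{2o}\ell^2$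 for every $n$. The factors of $T_3$ have the dual properties: $T_{3i}\in B_c$ is a partial isometry such that $T_{3i}T_{3i}^\star$ commutes with every $\widetilde Q_n$, while $T_{3o}\in B_c$, the orthogonal projection onto the closure of the range of $T_{3o}^\star$ commutes with every $P_n$, and $T_{3o}^\star P_n\ell^2$ is dense in $P_n\ell^2\cap T_{3o}^\star\ell^2$ for every $n$. Assume (A2): $T_{2i}^\star T_1T_{3i}^\star$ is compact. Then $$\inf_{Q\in B_c}\|T_{2i}^\star T_1T_{3i}^\star-Q\|=\inf_{Q\in B_c\cap\mathcal K}\|T_{2i}^\star T_1T_{3i}^\star-Q\|=\|T_{2i}^\star T_1T_{3i}^\star-Q_o\|$$ for some $Q_o\in B_c\cap\mathcal K$. If moreover (A1) $T_{2o}$ and $T_{3o}$ are invertible in $B_c$, then also before these factors are absorbed into the parameter there is a causal compact optimum: some $Q_o'\in B_c\cap\mathcal K$ minimizes $\|T_{2i}^\star T_1T_{3i}^\star-T_{2o}QT_{3o}\|$ over $Q\in B_c$. -/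

import Mathlib

open scoped InnerProductSpace

namespace CausalLTV

/-- The Hilbert space of square summable one-sided scalar sequences. -/
abbrev Ell2 (𝕜 : Type*) [RCLike 𝕜] : Type _ := lp (fun _ : ℕ => 𝕜) 2

/-- Bounded linear operators on `Ell2`, with the operator norm. -/
abbrev Op (𝕜 : Type*) [RCLike 𝕜] : Type _ := Ell2 𝕜 →L[𝕜] Ell2 𝕜

noncomputable section

variable {𝕜 : Type*} [RCLike 𝕜]

/-- The truncation `P_k (x₀, x₁, …) = (x₀, …, x_k, 0, 0, …)`;
its coordinates are computed in `trunc_apply`. -/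
def trunc (𝕜 : Type*) [RCLike 𝕜] (k : ℕ) : Op 𝕜 :=
  ∑ j ∈ Finset.range (k + 1),
    (innerSL 𝕜 (lp.single 2 j (1 : 𝕜) : Ell2 𝕜)).smulRight (lp.single 2 j (1 : 𝕜) : Ell2 𝕜)

theorem trunc_apply (k : ℕ) (x : Ell2 𝕜) (i : ℕ) :
    (trunc 𝕜 k x : ℕ → 𝕜) i = if i ≤ k then x i else 0 := by
  simp only [trunc, _root_.sum_apply, ContinuousLinearMap.smulRight_apply,
    innerSL_apply_apply, lp.inner_single_left, lp.coeFn_sum, Finset.sum_apply, lp.coeFn_smul,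
    Pi.smul_apply, lp.coeFn_single]
  simp [Pi.single_apply]

/-- `A` is causal: `P_k A P_k = P_k A` for every time `k`. -/
def IsCausal (A : Op 𝕜) : Prop :=
  ∀ k : ℕ, trunc 𝕜 k * A * trunc 𝕜 k = trunc 𝕜 k * A

/-- The projection `Q̃_n = I - P_n`. -/
def tail (𝕜 : Type*) [RCLike 𝕜] (n : ℕ) : Op 𝕜 := 1 - trunc 𝕜 n

/-- Partial isometry: norm preserving on the orthogonal complement of the null space. -/
def IsPartialIsometry (A : Op 𝕜) : Prop :=
  ∀ u ∈ (LinearMap.ker A.toLinearMap)ᗮ, ‖A u‖ = ‖u‖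

/-- The orthogonal projection onto the closure of the range of `A`. -/
def rangeProj (A : Op 𝕜) : Op 𝕜 :=
  (LinearMap.range A.toLinearMap).topologicalClosure.starProjection

/-- `U` is inner: a causal partial isometry such that `U* U` commutes with every `Q̃_n`. -/
def IsInner (U : Op 𝕜) : Prop :=
  IsCausal U ∧ IsPartialIsometry U ∧
    ∀ n, Commute (ContinuousLinearMap.adjoint U * U) (tail 𝕜 n)

/-- `A` is outer: it is causal, its range projection commutes with every `Q̃_n`, and
`A Q̃_n ℓ²` is dense in `Q̃_n ℓ² ∩ A ℓ²`. (It is contained there, since `A` is causal.) -/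
def IsOuter (A : Op 𝕜) : Prop :=
  IsCausal A ∧ (∀ n, Commute (rangeProj A) (tail 𝕜 n)) ∧
    ∀ n, Set.range (tail 𝕜 n) ∩ Set.range A ⊆ closure (A '' Set.range (tail 𝕜 n))

/-- `U` is co-inner: a causal partial isometry such that `U U*` commutes with every `Q̃_n`. -/
def IsCoInner (U : Op 𝕜) : Prop :=
  IsCausal U ∧ IsPartialIsometry U ∧
    ∀ n, Commute (U * ContinuousLinearMap.adjoint U) (tail 𝕜 n)

/-- `A` is co-outer: it is causal, and its adjoint is outer for the complementary nest
`{P_n ℓ²}`, which the adjoints of causal operators leave invariant. -/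
def IsCoOuter (A : Op 𝕜) : Prop :=
  IsCausal A ∧ (∀ n, Commute (rangeProj (ContinuousLinearMap.adjoint A)) (trunc 𝕜 n)) ∧
    ∀ n, Set.range (trunc 𝕜 n) ∩ Set.range (ContinuousLinearMap.adjoint A) ⊆
      closure (ContinuousLinearMap.adjoint A '' Set.range (trunc 𝕜 n))

/-- `A` is invertible in the algebra of causal operators. -/
def CausallyInvertible (A : Op 𝕜) : Prop :=
  IsCausal A ∧ ∃ B : Op 𝕜, IsCausal B ∧ A * B = 1 ∧ B * A = 1

/-- The operator `T₂ᵢ* T₁ T₃ᵢ*` that the Youla parameter has to approximate. -/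
def target (T₂ᵢ T₁ T₃ᵢ : Op 𝕜) : Op 𝕜 :=
  ContinuousLinearMap.adjoint T₂ᵢ * T₁ * ContinuousLinearMap.adjoint T₃ᵢ

end

end CausalLTV

/-! Read operators as matrices, so that causal means lower triangular. Subtracting a causal `Q` does
not change the corners `P_k b Q̃_k`, so each of them has norm at most the distance from `b` to the
causal operators.

Conversely, let `d` bound all corners. If `d = 0`, then `b` is itself causal. If `d > 0`,
compactness gives an `N` with `‖b Q̃_N‖ ≤ d`: the columns beyond `N` need no correction. The columns
`N, …, 0` are corrected from right to left, on and below the diagonal, each by Parrott's theorem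
(`exists_block_completion`), which keeps the norm at most `d`. Only finitely many columns change, so
the correction is compact.

Parrott's theorem itself amounts to extending a contraction for the form `d² ⟪x, y⟫ - ⟪A x, A y⟫`.
-/

namespace CausalLTV

/-! ### Extension of contractions and Parrott's theorem -/

section Extension

variable {𝕜 : Type*} [RCLike 𝕜]

/-- A contraction defined on a subspace of a semi-inner product space extends to the whole space,
by composing with the orthogonal projection in the completion. -/
theorem exists_contraction_extension {V F : Type*} [SeminormedAddCommGroup V]
    [InnerProductSpace 𝕜 V] [NormedAddCommGroup F] [NormedSpace 𝕜 F] [CompleteSpace F]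
    (W : Submodule 𝕜 V) (f : W →ₗ[𝕜] F) (hf : ∀ w : W, ‖f w‖ ≤ ‖(w : V)‖) :
    ∃ g : V →ₗ[𝕜] F, (∀ w : W, g w = f w) ∧ ∀ v, ‖g v‖ ≤ ‖v‖ := by
  let ι : V →ₗᵢ[𝕜] UniformSpace.Completion V := UniformSpace.Completion.toComplₗᵢ
  let e : W →ₗ[𝕜] UniformSpace.Completion V := ι.toLinearMap ∘ₗ W.subtype
  let K : Submodule 𝕜 (UniformSpace.Completion V) := (LinearMap.range e).topologicalClosure
  have : CompleteSpace K := (LinearMap.range e).isClosed_topologicalClosure.completeSpace_coe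
  have hmem : ∀ w, e w ∈ K := fun w =>
    (LinearMap.range e).le_topologicalClosure (LinearMap.mem_range_self e w)
  let e' : W →ₗ[𝕜] K := e.codRestrict K hmem
  have hdense : DenseRange e' := by
    intro y
    rw [closure_subtype, ← Set.range_comp]
    exact y.2
  have hnorm : ∀ w, ‖f w‖ ≤ 1 * ‖e' w‖ := by
    intro w
    have : ‖e' w‖ = ‖(w : V)‖ := ι.norm_map w
    rw [this, one_mul]
    exact hf w
  refine ⟨(f.extendOfNorm e').toLinearMap ∘ₗ K.orthogonalProjectionOnto.toLinearMap ∘ₗ ι.toLinearMap,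
    fun w => ?_, fun v => ?_⟩
  · have h1 : K.orthogonalProjectionOnto (ι w) = e' w :=
      Submodule.orthogonalProjectionOnto_mem_subspace_eq_self (e' w)
    have h2 := LinearMap.extendOfNorm_eq hdense ⟨1, hnorm⟩ w
    rw [← h1] at h2
    exact h2
  · calc ‖f.extendOfNorm e' (K.orthogonalProjectionOnto (ι v))‖
        ≤ 1 * ‖K.orthogonalProjectionOnto (ι v)‖ :=
          LinearMap.norm_extendOfNorm_apply_le hdense 1 hnorm _
      _ ≤ ‖ι v‖ := by rw [one_mul]; exact K.norm_orthogonalProjectionOnto_apply_le _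
      _ = ‖v‖ := ι.norm_map v

/-- The same for a contraction with respect to an arbitrary positive semidefinite form. -/
theorem exists_extension_of_core {V F : Type*} [AddCommGroup V] [Module 𝕜 V]
    [NormedAddCommGroup F] [NormedSpace 𝕜 F] [CompleteSpace F]
    (c : PreInnerProductSpace.Core 𝕜 V) (W : Submodule 𝕜 V) (f : W →ₗ[𝕜] F)
    (hf : ∀ w : W, ‖f w‖ ^ 2 ≤ RCLike.re (c.inner w w)) :
    ∃ g : V →ₗ[𝕜] F, (∀ w : W, g w = f w) ∧ ∀ v, ‖g v‖ ^ 2 ≤ RCLike.re (c.inner v v) := by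
  let : SeminormedAddCommGroup V := InnerProductSpace.Core.toSeminormedAddCommGroup (c := c)
  let : InnerProductSpace 𝕜 V := InnerProductSpace.ofCore c
  have hn : ∀ v : V, ‖v‖ ^ 2 = RCLike.re (c.inner v v) := fun v =>
    (InnerProductSpace.norm_sq_eq_re_inner (𝕜 := 𝕜) v)
  obtain ⟨g, hg, hb⟩ := exists_contraction_extension W f fun w =>
    (sq_le_sq₀ (norm_nonneg _) (norm_nonneg _)).1 ((hf w).trans_eq (hn w).symm)
  refine ⟨g, hg, fun v => ?_⟩
  rw [← hn]
  exact pow_le_pow_left₀ (norm_nonneg _) (hb v) 2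

variable {H F : Type*} [NormedAddCommGroup H] [InnerProductSpace 𝕜 H]
  [NormedAddCommGroup F] [InnerProductSpace 𝕜 F] [CompleteSpace F]

/-- The semi-inner product `d² ⟪x, y⟫ - ⟪A x, A y⟫` of an operator `A` of norm at most `d`. -/
@[reducible] def defectCore (A : H →L[𝕜] F) (d : ℝ) (hA : ∀ v, ‖A v‖ ≤ d * ‖v‖) :
    PreInnerProductSpace.Core 𝕜 H where
  inner x y := ((d ^ 2 : ℝ) : 𝕜) * inner 𝕜 x y - inner 𝕜 (A x) (A y)
  conj_inner_symm x y := by simp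
  re_inner_nonneg x := by
    have h := pow_le_pow_left₀ (norm_nonneg _) (hA x) 2
    rw [map_sub, RCLike.re_ofReal_mul, inner_self_eq_norm_sq, inner_self_eq_norm_sq]
    rw [mul_pow] at h
    linarith
  add_left x y z := by simp only [map_add, inner_add_left]; ring
  smul_left x y r := by simp only [map_smul, inner_smul_left]; ring

/-- Parrott's completion theorem: the missing corner of a partially defined operator can be filled
without increasing the norm. -/
theorem exists_column_completion (A : H →L[𝕜] F) {d : ℝ} (hA : ∀ v, ‖A v‖ ≤ d * ‖v‖)
    (W : Submodule 𝕜 H) (f : W →ₗ[𝕜] F)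
    (hf : ∀ w : W, ‖A w‖ ^ 2 + ‖f w‖ ^ 2 ≤ d ^ 2 * ‖(w : H)‖ ^ 2) :
    ∃ g : H →L[𝕜] F, (∀ w : W, g w = f w) ∧
      ∀ v, ‖A v‖ ^ 2 + ‖g v‖ ^ 2 ≤ d ^ 2 * ‖v‖ ^ 2 := by
  have hre : ∀ v, RCLike.re ((defectCore A d hA).inner v v) = d ^ 2 * ‖v‖ ^ 2 - ‖A v‖ ^ 2 := by
    intro v
    change RCLike.re (((d ^ 2 : ℝ) : 𝕜) * inner 𝕜 v v - inner 𝕜 (A v) (A v)) = _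
    rw [map_sub, RCLike.re_ofReal_mul, inner_self_eq_norm_sq, inner_self_eq_norm_sq]
  obtain ⟨g, hg, hb⟩ := exists_extension_of_core (defectCore A d hA) W f fun w => by
    rw [hre]; linarith [hf w]
  have hb' : ∀ v, ‖A v‖ ^ 2 + ‖g v‖ ^ 2 ≤ d ^ 2 * ‖v‖ ^ 2 := fun v => by
    have := hb v
    rw [hre] at this
    linarith
  -- The sign of `d` is not prescribed; the estimate controls only `d ^ 2`.
  refine ⟨g.mkContinuous |d| fun v => ?_, hg, hb'⟩
  refine (sq_le_sq₀ (norm_nonneg _) (by positivity)).1 ?_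
  rw [mul_pow, sq_abs]
  linarith [hb' v, sq_nonneg ‖A v‖]

/-- One completion step for a decomposition `1 = P + Q` of the rows and projections `E' ≤ E` of the
columns. -/
theorem exists_block_completion (C P Q E E' : H →L[𝕜] H) [CompleteSpace H] {d : ℝ} (hd : 0 ≤ d)
    (hPQ : ∀ v, ‖P v‖ ^ 2 + ‖Q v‖ ^ 2 = ‖v‖ ^ 2) (hadd : P + Q = 1) (hPP : P * P = P)
    (hE : E * E = E) (hEE' : E * E' = E') (hE' : E' * E' = E')
    (hEn : ∀ v, ‖E v‖ ≤ ‖v‖) (hrow : ‖P * C * E‖ ≤ d) (hcol : ‖C * E'‖ ≤ d) :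
    ∃ Y : H →L[𝕜] H, P * Y = 0 ∧ Y * E' = 0 ∧ ‖(C - Y) * E‖ ≤ d := by
  have hPQ0 : P * Q = 0 := by
    rw [eq_sub_of_add_eq' hadd, mul_sub, mul_one, hPP, sub_self]
  have hQQ : Q * Q = Q := by
    have := congrArg (· * Q) hadd
    simpa [add_mul, hPQ0] using this
  have hfix : ∀ w : LinearMap.range E'.toLinearMap, E' (w : H) = w := by
    rintro ⟨_, x, rfl⟩
    exact DFunLike.congr_fun hE' x
  have hfixE : ∀ w : LinearMap.range E'.toLinearMap, E (w : H) = w := by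
    intro w
    rw [← hfix w]
    exact DFunLike.congr_fun hEE' (w : H)
  have hA : ∀ v, ‖(P * C * E) v‖ ≤ d * ‖v‖ := fun v => (P * C * E).le_of_opNorm_le hrow v
  -- The row `P C E` is kept, and `Q C` is prescribed on the range of `E'`. Compatibility there is
  -- Pythagoras together with `hcol`.
  obtain ⟨g, hg, hb⟩ := exists_column_completion (P * C * E) hA (LinearMap.range E'.toLinearMap)
    ((Q * C).toLinearMap ∘ₗ (LinearMap.range E'.toLinearMap).subtype) (by
      intro w
      have h1 : (P * C * E) (w : H) = P (C w) := by
        change P (C (E w)) = _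
        rw [hfixE]
      have h2 := (C * E').le_of_opNorm_le hcol (w : H)
      have h3 : (C * E') (w : H) = C w := by
        change C (E' w) = _
        rw [hfix]
      rw [h3] at h2
      rw [h1]
      change ‖P (C w)‖ ^ 2 + ‖Q (C w)‖ ^ 2 ≤ _
      rw [hPQ, ← mul_pow]
      exact pow_le_pow_left₀ (norm_nonneg _) h2 2)
  -- Subtracting this replaces the lower row `Q C E` by `Q g E`.
  refine ⟨Q * (C - g) * E, ?_, ?_, ?_⟩
  · rw [← mul_assoc, ← mul_assoc, hPQ0, zero_mul, zero_mul]
  · rw [mul_assoc, hEE']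
    ext v
    have h := hg ⟨E' v, v, rfl⟩
    change g (E' v) = Q (C (E' v)) at h
    change Q (C (E' v) - g (E' v)) = 0
    have h' : Q (Q (C (E' v))) = Q (C (E' v)) := DFunLike.congr_fun hQQ _
    rw [map_sub, h, h', sub_self]
  · have hrep : (C - Q * (C - g) * E) * E = P * C * E + Q * g * E := by
      have h1 : C * E = P * C * E + Q * C * E := by
        rw [← add_mul, ← add_mul, hadd, one_mul]
      rw [sub_mul, mul_assoc _ E E, hE, mul_sub, sub_mul, h1]
      abel
    rw [hrep]
    refine ContinuousLinearMap.opNorm_le_bound _ hd fun v => ?_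
    refine (sq_le_sq₀ (norm_nonneg _) (by positivity)).1 ?_
    have hP : P ((P * C * E + Q * g * E) v) = (P * C * E) (E v) := by
      have h : P * (P * C * E + Q * g * E) = P * C * E * E := by
        rw [mul_add, mul_assoc _ E E, hE]
        simp only [← mul_assoc, hPP, hPQ0, zero_mul, add_zero]
      exact DFunLike.congr_fun h v
    have hQ : Q ((P * C * E + Q * g * E) v) = Q (g (E v)) := by
      have hQP : Q * P = 0 := by
        have := congrArg (· * P) hadd
        simpa [add_mul, hPP] using this
      have h : Q * (P * C * E + Q * g * E) = Q * g * E := by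
        rw [mul_add]
        simp only [← mul_assoc, hQP, hQQ, zero_mul, zero_add]
      exact DFunLike.congr_fun h v
    have h1 := hb (E v)
    have h2 := hPQ (g (E v))
    have h3 : d ^ 2 * ‖E v‖ ^ 2 ≤ d ^ 2 * ‖v‖ ^ 2 := by
      gcongr
      exact hEn v
    -- `g` may have a component in the range of `P`; discarding it only lowers the norm.
    rw [← hPQ, hP, hQ, mul_pow]
    linarith [sq_nonneg ‖P (g (E v))‖]

end Extension

/-! ### Truncations and the tails of compact operators -/

section Truncation

variable {𝕜 : Type*} [RCLike 𝕜]

theorem trunc_mul_trunc (m n : ℕ) : trunc 𝕜 m * trunc 𝕜 n = trunc 𝕜 (min m n) := by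
  ext x i
  change (trunc 𝕜 m (trunc 𝕜 n x) : ℕ → 𝕜) i = _
  simp only [trunc_apply, le_min_iff]
  split_ifs <;> tauto

theorem trunc_mul_self (n : ℕ) : trunc 𝕜 n * trunc 𝕜 n = trunc 𝕜 n := by
  rw [trunc_mul_trunc, min_self]

theorem tail_apply (n : ℕ) (x : Ell2 𝕜) (i : ℕ) :
    (tail 𝕜 n x : ℕ → 𝕜) i = if i ≤ n then 0 else x i := by
  change (x : ℕ → 𝕜) i - (trunc 𝕜 n x : ℕ → 𝕜) i = _
  rw [trunc_apply]
  split_ifs <;> simp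

theorem tail_mul_tail (m n : ℕ) : tail 𝕜 m * tail 𝕜 n = tail 𝕜 (max m n) := by
  ext x i
  change (tail 𝕜 m (tail 𝕜 n x) : ℕ → 𝕜) i = _
  simp only [tail_apply, le_max_iff]
  split_ifs <;> tauto

theorem trunc_add_tail (n : ℕ) : trunc 𝕜 n + tail 𝕜 n = 1 := by
  rw [tail]; abel

theorem norm_trunc_sq_add_norm_tail_sq (n : ℕ) (x : Ell2 𝕜) :
    ‖trunc 𝕜 n x‖ ^ 2 + ‖tail 𝕜 n x‖ ^ 2 = ‖x‖ ^ 2 := by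
  have h : inner 𝕜 (trunc 𝕜 n x) (tail 𝕜 n x) = 0 := by
    rw [lp.inner_eq_tsum]
    refine (tsum_congr fun i => ?_).trans tsum_zero
    rw [trunc_apply, tail_apply]
    split_ifs <;> simp
  have hx : trunc 𝕜 n x + tail 𝕜 n x = x := DFunLike.congr_fun (trunc_add_tail n) x
  have h2 := norm_add_sq_eq_norm_sq_add_norm_sq_of_inner_eq_zero _ _ h
  rw [hx] at h2
  linarith

theorem norm_trunc_apply_le (n : ℕ) (x : Ell2 𝕜) : ‖trunc 𝕜 n x‖ ≤ ‖x‖ :=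
  (sq_le_sq₀ (norm_nonneg _) (norm_nonneg _)).1 <| by
    linarith [norm_trunc_sq_add_norm_tail_sq n x, sq_nonneg ‖tail 𝕜 n x‖]

theorem norm_tail_apply_le (n : ℕ) (x : Ell2 𝕜) : ‖tail 𝕜 n x‖ ≤ ‖x‖ :=
  (sq_le_sq₀ (norm_nonneg _) (norm_nonneg _)).1 <| by
    linarith [norm_trunc_sq_add_norm_tail_sq n x, sq_nonneg ‖trunc 𝕜 n x‖]

theorem norm_trunc_le (n : ℕ) : ‖trunc 𝕜 n‖ ≤ 1 :=
  ContinuousLinearMap.opNorm_le_bound _ zero_le_one fun x => by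
    rw [one_mul]; exact norm_trunc_apply_le n x

theorem norm_tail_le (n : ℕ) : ‖tail 𝕜 n‖ ≤ 1 :=
  ContinuousLinearMap.opNorm_le_bound _ zero_le_one fun x => by
    rw [one_mul]; exact norm_tail_apply_le n x

theorem inner_tail_left (n : ℕ) (x y : Ell2 𝕜) :
    inner 𝕜 (tail 𝕜 n x) y = inner 𝕜 (tail 𝕜 n x) (tail 𝕜 n y) := by
  rw [lp.inner_eq_tsum, lp.inner_eq_tsum]
  refine tsum_congr fun i => ?_
  rw [tail_apply, tail_apply]
  split_ifs <;> simp

theorem tendsto_tail_apply (x : Ell2 𝕜) :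
    Filter.Tendsto (fun n => tail 𝕜 n x) Filter.atTop (nhds 0) := by
  have h := (lp.hasSum_single (p := 2) (by simp) x).tendsto_sum_nat
  have h2 := (h.comp (Filter.tendsto_add_atTop_nat 1)).const_sub x
  rw [sub_self] at h2
  refine h2.congr fun n => ?_
  change x - _ = x - trunc 𝕜 n x
  congr 1
  ext i
  rw [trunc_apply]
  rw [Function.comp_apply, lp.coeFn_sum, Finset.sum_apply]
  simp only [lp.coeFn_single, Pi.single_apply]
  simp

theorem isCompactOperator_trunc (n : ℕ) : IsCompactOperator (trunc 𝕜 n) := by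
  have h : trunc 𝕜 n ∈ compactOperator (RingHom.id 𝕜) (Ell2 𝕜) (Ell2 𝕜) := by
    refine Submodule.sum_mem _ fun j _ => ?_
    have hf : IsCompactOperator (innerSL 𝕜 (lp.single 2 j (1 : 𝕜) : Ell2 𝕜)) :=
      isCompactOperator_of_locallyCompactSpace_dom _
    exact hf.clm_comp
      ((ContinuousLinearMap.id 𝕜 𝕜).smulRight (lp.single 2 j (1 : 𝕜) : Ell2 𝕜))
  exact h

/-- The tails of a compact operator are eventually small in norm. -/
theorem exists_norm_mul_tail_le (b : Op 𝕜) (hb : IsCompactOperator b) {d : ℝ} (hd : 0 < d) :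
    ∃ N, ‖b * tail 𝕜 N‖ ≤ d := by
  by_contra! hcon
  have hx : ∀ n, ∃ x : Ell2 𝕜, ‖x‖ < 1 ∧ d < ‖b (tail 𝕜 n x)‖ := fun n =>
    (b * tail 𝕜 n).exists_lt_apply_of_lt_opNorm (hcon n)
  choose x hx1 hx2 using hx
  have hball : ∀ n, tail 𝕜 n (x n) ∈ Metric.closedBall (0 : Ell2 𝕜) 1 := fun n => by
    rw [mem_closedBall_zero_iff]
    exact (norm_tail_apply_le n _).trans (hx1 n).le
  obtain ⟨y, -, φ, hφ, hlim⟩ :=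
    (hb.isCompact_closure_image_closedBall 1).tendsto_subseq fun n =>
      subset_closure (Set.mem_image_of_mem b (hball n))
  have hlim' : Filter.Tendsto (fun n => b (tail 𝕜 (φ n) (x (φ n)))) Filter.atTop (nhds y) := hlim
  -- The vectors `tail 𝕜 n (x n)` tend weakly to zero, so the norm limit of their images must
  -- vanish, although its norm is at least `d`.
  have hz : ∀ z : Ell2 𝕜, inner 𝕜 y z = 0 := by
    intro z
    refine tendsto_nhds_unique (hlim'.inner tendsto_const_nhds) ?_
    have h0 := ((tendsto_tail_apply (ContinuousLinearMap.adjoint b z)).comp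
      hφ.tendsto_atTop).norm
    rw [norm_zero] at h0
    refine squeeze_zero_norm (fun n => ?_) h0
    rw [← ContinuousLinearMap.adjoint_inner_right, inner_tail_left]
    refine (norm_inner_le_norm _ _).trans ?_
    exact mul_le_of_le_one_left (norm_nonneg _) (mem_closedBall_zero_iff.1 (hball _))
  have hy : y = 0 := inner_self_eq_zero.1 (hz y)
  have : d ≤ ‖y‖ := ge_of_tendsto' hlim'.norm fun n => (hx2 (φ n)).le
  rw [hy, norm_zero] at this
  linarith

end Truncation

/-! ### Distance to the causal operators -/

section Causal

variable {𝕜 : Type*} [RCLike 𝕜]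

theorem isCausal_iff {A : Op 𝕜} : IsCausal A ↔ ∀ k, trunc 𝕜 k * A * tail 𝕜 k = 0 := by
  refine forall_congr' fun k => ?_
  rw [tail, mul_sub, mul_one, sub_eq_zero, eq_comm]

theorem isCausal_zero : IsCausal (0 : Op 𝕜) := fun k => by simp

theorem IsCausal.add {A B : Op 𝕜} (hA : IsCausal A) (hB : IsCausal B) : IsCausal (A + B) :=
  fun k => by rw [mul_add, add_mul, hA k, hB k]

theorem IsCausal.mul {A B : Op 𝕜} (hA : IsCausal A) (hB : IsCausal B) : IsCausal (A * B) := by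
  intro k
  rw [← mul_assoc, ← hA k, mul_assoc (trunc 𝕜 k * A), mul_assoc (trunc 𝕜 k * A), hB k]

/-- The easy half of Arveson's distance formula. -/
theorem norm_trunc_mul_mul_tail_le (b : Op 𝕜) {Q : Op 𝕜} (hQ : IsCausal Q) (k : ℕ) :
    ‖trunc 𝕜 k * b * tail 𝕜 k‖ ≤ ‖b - Q‖ := by
  have h : trunc 𝕜 k * b * tail 𝕜 k = trunc 𝕜 k * (b - Q) * tail 𝕜 k := by
    rw [mul_sub, sub_mul, isCausal_iff.1 hQ k, sub_zero]
  rw [h]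
  calc ‖trunc 𝕜 k * (b - Q) * tail 𝕜 k‖ ≤ ‖trunc 𝕜 k‖ * ‖b - Q‖ * ‖tail 𝕜 k‖ :=
        (norm_mul_le _ _).trans (by gcongr; exact norm_mul_le _ _)
    _ ≤ 1 * ‖b - Q‖ * 1 := by
        gcongr
        · exact norm_trunc_le k
        · exact norm_tail_le k
    _ = ‖b - Q‖ := by ring

/-- Filling the columns `n + 1, …, N` below the diagonal. -/
theorem exists_causal_correction (b : Op 𝕜) {d : ℝ} (hd : 0 ≤ d)
    (hrow : ∀ k, ‖trunc 𝕜 k * b * tail 𝕜 k‖ ≤ d) {N : ℕ} (hN : ‖b * tail 𝕜 N‖ ≤ d)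
    {n : ℕ} (hn : n ≤ N) :
    ∃ X : Op 𝕜, IsCausal X ∧ X * tail 𝕜 N = 0 ∧ ‖(b - X) * tail 𝕜 n‖ ≤ d := by
  induction hn using Nat.decreasingInduction with
  | self => exact ⟨0, isCausal_zero, zero_mul _, by rwa [sub_zero]⟩
  | of_succ n hn ih =>
    obtain ⟨X, hX, hXN, hXn⟩ := ih
    -- The causal correction made so far does not touch the corner of `b`.
    have hr : ‖trunc 𝕜 n * (b - X) * tail 𝕜 n‖ ≤ d := by
      rw [mul_sub, sub_mul, isCausal_iff.1 hX n, sub_zero]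
      exact hrow n
    -- `tail 𝕜 n` and `tail 𝕜 (n + 1)` differ by column `n + 1`, whose free entries are the rows
    -- from `n + 1` on.
    obtain ⟨Y, hPY, hYE', hY⟩ := exists_block_completion (b - X) (trunc 𝕜 n) (tail 𝕜 n)
      (tail 𝕜 n) (tail 𝕜 (n + 1)) hd (norm_trunc_sq_add_norm_tail_sq n) (trunc_add_tail n)
      (trunc_mul_self n) (by rw [tail_mul_tail, max_self])
      (by rw [tail_mul_tail, max_eq_right n.le_succ]) (by rw [tail_mul_tail, max_self])
      (norm_tail_apply_le n) hr hXn
    have htail : ∀ k, n + 1 ≤ k → Y * tail 𝕜 k = 0 := fun k hk => by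
      rw [← max_eq_right hk, ← tail_mul_tail, ← mul_assoc, hYE', zero_mul]
    have hYc : IsCausal Y := isCausal_iff.2 fun k => by
      rcases Nat.lt_or_ge n k with hk | hk
      · rw [mul_assoc, htail k hk, mul_zero]
      · rw [← min_eq_left hk, ← trunc_mul_trunc, mul_assoc (trunc 𝕜 k), hPY, mul_zero, zero_mul]
    refine ⟨X + Y, hX.add hYc, ?_, ?_⟩
    · rw [add_mul, hXN, htail N hn, add_zero]
    · rwa [← sub_sub]

/-- A compact operator has a compact best causal approximation. -/
theorem exists_compact_causal_norm_sub_le (b : Op 𝕜) (hb : IsCompactOperator b) {d : ℝ}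
    (hd : 0 ≤ d) (hrow : ∀ k, ‖trunc 𝕜 k * b * tail 𝕜 k‖ ≤ d) :
    ∃ Q : Op 𝕜, IsCausal Q ∧ IsCompactOperator Q ∧ ‖b - Q‖ ≤ d := by
  rcases hd.eq_or_lt with rfl | hpos
  · refine ⟨b, isCausal_iff.2 fun k => norm_le_zero_iff.1 (hrow k), hb, ?_⟩
    rw [sub_self, norm_zero]
  obtain ⟨N, hN⟩ := exists_norm_mul_tail_le b hb hpos
  obtain ⟨X, hX, hXN, hX0⟩ := exists_causal_correction b hd hrow hN N.zero_le
  -- Column `0` remains. Causality leaves it entirely free, hence the row projection `P = 0`.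
  obtain ⟨Y, -, hYE', hY⟩ := exists_block_completion (b - X) 0 1 1 (tail 𝕜 0) hd
    (fun v => by simp) (zero_add 1) (zero_mul 0) (one_mul 1) (one_mul _)
    (by rw [tail_mul_tail, max_self]) (fun v => le_rfl) (by simpa using hd) hX0
  have htail : ∀ k, Y * tail 𝕜 k = 0 := fun k => by
    rw [← max_eq_right k.zero_le, ← tail_mul_tail, ← mul_assoc, hYE', zero_mul]
  have hcomp : X + Y = (X + Y) * trunc 𝕜 N := by
    have h : (X + Y) * tail 𝕜 N = 0 := by rw [add_mul, hXN, htail, add_zero]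
    rwa [tail, mul_sub, mul_one, sub_eq_zero] at h
  refine ⟨X + Y, hX.add (isCausal_iff.2 fun k => by rw [mul_assoc, htail, mul_zero]), ?_, ?_⟩
  · rw [hcomp]
    exact (isCompactOperator_trunc N).clm_comp (X + Y)
  · rwa [← sub_sub, ← mul_one (b - X - Y)]

theorem bddBelow_norm_sub {p : Op 𝕜 → Prop} (b : Op 𝕜) :
    BddBelow (Set.range fun Q : {Q : Op 𝕜 // p Q} => ‖b - Q.1‖) :=
  ⟨0, by rintro _ ⟨Q, rfl⟩; exact norm_nonneg _⟩

/-- The infimum itself bounds every corner, so it can serve as `d` in the completion; this gives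
attainment without a limiting argument. -/
theorem exists_compact_causal_optimum (b : Op 𝕜) (hb : IsCompactOperator b) :
    (⨅ Q : {Q : Op 𝕜 // IsCausal Q}, ‖b - Q.1‖)
        = (⨅ Q : {Q : Op 𝕜 // IsCausal Q ∧ IsCompactOperator Q}, ‖b - Q.1‖) ∧
      ∃ Qo : Op 𝕜, IsCausal Qo ∧ IsCompactOperator Qo ∧
        ‖b - Qo‖ = ⨅ Q : {Q : Op 𝕜 // IsCausal Q}, ‖b - Q.1‖ := by
  have : Nonempty {Q : Op 𝕜 // IsCausal Q} := ⟨⟨0, isCausal_zero⟩⟩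
  have : Nonempty {Q : Op 𝕜 // IsCausal Q ∧ IsCompactOperator Q} :=
    ⟨⟨0, isCausal_zero, isCompactOperator_zero⟩⟩
  obtain ⟨Qo, hc, hk, hle⟩ := exists_compact_causal_norm_sub_le b hb
    (d := ⨅ Q : {Q : Op 𝕜 // IsCausal Q}, ‖b - Q.1‖)
    (le_ciInf fun Q => norm_nonneg _)
    (fun k => le_ciInf fun Q => norm_trunc_mul_mul_tail_le b Q.2 k)
  refine ⟨le_antisymm ?_ ?_, Qo, hc, hk, le_antisymm hle ?_⟩
  · exact le_ciInf fun Q => ciInf_le (bddBelow_norm_sub b) ⟨Q.1, Q.2.1⟩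
  · exact (ciInf_le (bddBelow_norm_sub b) ⟨Qo, hc, hk⟩).trans hle
  · exact ciInf_le (bddBelow_norm_sub b) (⟨Qo, hc⟩ : {Q : Op 𝕜 // IsCausal Q})

end Causal

end CausalLTV

open CausalLTV in
theorem mainTheorem3 {𝕜 : Type*} [RCLike 𝕜] :
    -- distance from an arbitrary compact operator `b`
    (∀ b : Op 𝕜, IsCompactOperator b →
      (⨅ Q : {Q : Op 𝕜 // IsCausal Q}, ‖b - Q.1‖)
          = (⨅ Q : {Q : Op 𝕜 // IsCausal Q ∧ IsCompactOperator Q}, ‖b - Q.1‖) ∧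
      ∃ Qo : Op 𝕜, IsCausal Qo ∧ IsCompactOperator Qo ∧
        ‖b - Qo‖ = ⨅ Q : {Q : Op 𝕜 // IsCausal Q}, ‖b - Q.1‖) ∧
    -- the Youla parameter problem
    (∀ T₁ T₂ T₃ T₂ᵢ T₂ₒ T₃ₒ T₃ᵢ : Op 𝕜,
      IsCausal T₁ → IsCausal T₂ → IsCausal T₃ →
      T₂ = T₂ᵢ * T₂ₒ → IsInner T₂ᵢ → IsOuter T₂ₒ →
      T₃ = T₃ₒ * T₃ᵢ → IsCoOuter T₃ₒ → IsCoInner T₃ᵢ →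
      IsCompactOperator (target T₂ᵢ T₁ T₃ᵢ) →
      ((⨅ Q : {Q : Op 𝕜 // IsCausal Q},
            ‖target T₂ᵢ T₁ T₃ᵢ - Q.1‖)
          = (⨅ Q : {Q : Op 𝕜 // IsCausal Q ∧ IsCompactOperator Q},
            ‖target T₂ᵢ T₁ T₃ᵢ - Q.1‖) ∧
        ∃ Qo : Op 𝕜, IsCausal Qo ∧ IsCompactOperator Qo ∧
          ‖target T₂ᵢ T₁ T₃ᵢ - Qo‖
            = ⨅ Q : {Q : Op 𝕜 // IsCausal Q},
              ‖target T₂ᵢ T₁ T₃ᵢ - Q.1‖) ∧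
      -- the same before the invertible outer factors are absorbed into the parameter
      (CausallyInvertible T₂ₒ → CausallyInvertible T₃ₒ →
        ∃ Qo : Op 𝕜, IsCausal Qo ∧ IsCompactOperator Qo ∧
          ∀ Q : Op 𝕜, IsCausal Q →
            ‖target T₂ᵢ T₁ T₃ᵢ - T₂ₒ * Qo * T₃ₒ‖
              ≤ ‖target T₂ᵢ T₁ T₃ᵢ - T₂ₒ * Q * T₃ₒ‖)) := by
  refine ⟨exists_compact_causal_optimum, ?_⟩
  intro T₁ T₂ T₃ T₂ᵢ T₂ₒ T₃ₒ T₃ᵢ _ _ _ _ _ _ _ _ _ hcomp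
  have hopt := exists_compact_causal_optimum (target T₂ᵢ T₁ T₃ᵢ) hcomp
  refine ⟨hopt, ?_⟩
  rintro ⟨hA, A, hAc, hA1, -⟩ ⟨hB, B, hBc, -, hB1⟩
  obtain ⟨-, Qo, hc, hk, hmin⟩ := hopt
  -- The inverses of the outer factors carry the optimum `Qo` back to the original parameter, and
  -- every competitor `T₂ₒ * Q * T₃ₒ` is causal.
  refine ⟨A * Qo * B, (hAc.mul hc).mul hBc, (hk.clm_comp A).comp_clm B, fun Q hQ => ?_⟩
  have h : T₂ₒ * (A * Qo * B) * T₃ₒ = Qo := by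
    rw [mul_assoc, mul_assoc (A * Qo), hB1, mul_one, ← mul_assoc, hA1, one_mul]
  rw [h, hmin]
  exact ciInf_le (bddBelow_norm_sub (target T₂ᵢ T₁ T₃ᵢ))
    (⟨T₂ₒ * Q * T₃ₒ, (hA.mul hQ).mul hB⟩ : {Q : Op 𝕜 // IsCausal Q})
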